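/- For real $a \le b$, let $G_{[a,b]}$ be the graph whose vertex set is the Euclidean plane $\mathbb{R}^2$ and in which two distinct points $x, y$ are adjacent if and only if $a \le \operatorname{dist}(x,y) \le b$. A proper colouring of $G_{[a,b]}$ is a map $c : \mathbb{R}^2 \to K$ into an arbitrary (possibly infinite) set $K$ of colours such that $c(x) \neq c(y)$ whenever $x$ and $y$ are adjacent. **Lemma 3.1.** Let $b > 1$, let $c$ be a proper colouring of $G_{[1,b]}$, and let $0 < \varepsilon < b - 1$. Then there exists a point $x \in \mathbb{R}^2$ such that the closed ball $\{p \in \mathbb{R}^2 : \operatorname{dist}(p,x) \le \varepsilon\}$ contains points of at least $3$ colours, that is, the set $\{c(p) : p \in \mathbb{R}^2,\ \operatorname{dist}(p,x) \le \varepsilon\}$ has at least $3$ elements. -/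

import Mathlib

/-- The distance graph `G_[a,b]` on the Euclidean plane: two points are adjacent when their distance
lies in `[a, b]`. The requirement `x ≠ y` only excludes loops; it is automatic for `a > 0`. -/
def distanceGraph (a b : ℝ) : SimpleGraph (EuclideanSpace ℝ (Fin 2)) where
  Adj x y := x ≠ y ∧ a ≤ dist x y ∧ dist x y ≤ b
  symm := ⟨fun x y h => ⟨h.1.symm, by simpa only [dist_comm] using h.2⟩⟩
  loopless := ⟨fun _ h => h.1 rfl⟩

/-! A same-colour chain with steps at most `ε < b - 1` cannot jump over the forbidden distances `[1,
b]`, so it stays within distance 1 of its start. Label the points of a fine grid on a square of side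
at least 1 by whether such chains reach the left half-plane (0), failing that the lower one (1), or
neither (2). This is a Sperner labelling, and close points with different labels have different
colours, so a rainbow triangle gives three colours. -/

/-- The signed step from `a` to `b` around the oriented triangle `0 → 1 → 2 → 0`. -/
def cyclicStep (a b : Fin 3) : ℤ :=
  if b = a then 0 else if b = a + 1 then 1 else -1

theorem cyclicStep_add_of_not_rainbow (x y z : Fin 3) (h : ¬(x ≠ y ∧ y ≠ z ∧ x ≠ z)) :
    cyclicStep x y + cyclicStep y z = cyclicStep x z := by
  revert x y z; decide

/-- A path missing one label cannot wind around the triangle, so its steps have a potential `g` and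
telescope. -/
theorem sum_cyclicStep_eq_sub {n : ℕ} {f : ℕ → Fin 3} {g : Fin 3 → ℤ} {s : Fin 3}
    (hf : ∀ i ≤ n, f i ≠ s)
    (hg : ∀ a b : Fin 3, a ≠ s → b ≠ s → cyclicStep a b = g b - g a) :
    ∑ i ∈ Finset.range n, cyclicStep (f i) (f (i + 1)) = g (f n) - g (f 0) := by
  rw [← Finset.sum_range_sub (fun i => g (f i))]
  refine Finset.sum_congr rfl fun i hi => ?_
  have hi := Finset.mem_range.1 hi
  exact hg _ _ (hf i (by omega)) (hf (i + 1) (by omega))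

/-- If no grid square has a rainbow half, the steps along the boundary of the grid cancel. -/
theorem sum_cyclicStep_boundary {m n : ℕ} {L : ℕ → ℕ → Fin 3}
    (h : ∀ i < m, ∀ j < n,
      cyclicStep (L i j) (L (i + 1) j) + cyclicStep (L (i + 1) j) (L (i + 1) (j + 1)) =
        cyclicStep (L i j) (L i (j + 1)) + cyclicStep (L i (j + 1)) (L (i + 1) (j + 1))) :
    ∑ i ∈ Finset.range m, cyclicStep (L i 0) (L (i + 1) 0) +
        ∑ j ∈ Finset.range n, cyclicStep (L m j) (L m (j + 1)) =
      ∑ j ∈ Finset.range n, cyclicStep (L 0 j) (L 0 (j + 1)) +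
        ∑ i ∈ Finset.range m, cyclicStep (L i n) (L (i + 1) n) := by
  have key : ∀ i < m, ∀ k ≤ n,
      cyclicStep (L i 0) (L (i + 1) 0) +
          ∑ j ∈ Finset.range k, cyclicStep (L (i + 1) j) (L (i + 1) (j + 1)) =
        ∑ j ∈ Finset.range k, cyclicStep (L i j) (L i (j + 1)) +
          cyclicStep (L i k) (L (i + 1) k) := by
    intro i hi k
    induction k with
    | zero => simp
    | succ k ih =>
      intro hk
      rw [Finset.sum_range_succ, Finset.sum_range_succ]
      linarith [ih (by omega), h i hi k (by omega)]
  suffices ∀ k ≤ m,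
      ∑ i ∈ Finset.range k, cyclicStep (L i 0) (L (i + 1) 0) +
          ∑ j ∈ Finset.range n, cyclicStep (L k j) (L k (j + 1)) =
        ∑ j ∈ Finset.range n, cyclicStep (L 0 j) (L 0 (j + 1)) +
          ∑ i ∈ Finset.range k, cyclicStep (L i n) (L (i + 1) n) from this m le_rfl
  intro k
  induction k with
  | zero => simp
  | succ k ih =>
    intro hk
    rw [Finset.sum_range_succ, Finset.sum_range_succ]
    linarith [ih (by omega), key k (by omega) n le_rfl]

/-- A form of Sperner's lemma on a square grid, each cell of which is cut by a diagonal. -/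
theorem exists_rainbow_triangle {n : ℕ} {L : ℕ → ℕ → Fin 3}
    (left : ∀ j ≤ n, L 0 j = 0) (bottom : ∀ i ≤ n, L i 0 ≠ 2)
    (right : ∀ j ≤ n, L n j ≠ 0) (top : ∀ i ≤ n, L i n ≠ 1) :
    ∃ i j, (L i j ≠ L (i + 1) j ∧ L (i + 1) j ≠ L (i + 1) (j + 1) ∧
        L i j ≠ L (i + 1) (j + 1)) ∨
      (L i j ≠ L i (j + 1) ∧ L i (j + 1) ≠ L (i + 1) (j + 1) ∧
        L i j ≠ L (i + 1) (j + 1)) := by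
  by_contra! hcon
  have hbd := sum_cyclicStep_boundary (m := n) (n := n) (L := L) fun i _ j _ => by
    rw [cyclicStep_add_of_not_rainbow _ _ _ fun h => h.2.2 ((hcon i j).1 h.1 h.2.1),
      cyclicStep_add_of_not_rainbow _ _ _ fun h => h.2.2 ((hcon i j).2 h.1 h.2.1)]
  -- The value of `g` at the avoided label is junk. The two boundary routes sum to 2 and -1,
  -- differing by one full turn.
  rw [sum_cyclicStep_eq_sub (f := fun i => L i 0) (g := ![0, 1, 0]) bottom (by decide),
    sum_cyclicStep_eq_sub (f := fun j => L n j) (g := ![0, 1, 2]) right (by decide),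
    sum_cyclicStep_eq_sub (f := fun j => L 0 j) (g := ![0, 1, 0]) (s := 2)
      (fun j hj => by simp [left j hj]) (by decide),
    sum_cyclicStep_eq_sub (f := fun i => L i n) (g := ![3, 0, 2]) top (by decide)] at hbd
  have h00 := left 0 (Nat.zero_le n)
  have h0n := left n le_rfl
  have hn0 : L n 0 = 1 := by
    have h1 := bottom n le_rfl
    have h2 := right 0 (Nat.zero_le n)
    omega
  have hnn : L n n = 2 := by
    have h1 := top n le_rfl
    have h2 := right n le_rfl
    omega
  simp [h00, h0n, hn0, hnn] at hbd

/-- `p` and `q` are at distance at most `ε` and have the same colour. -/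
def MonochromaticStep {X K : Type*} [PseudoMetricSpace X] (c : X → K) (ε : ℝ) (p q : X) : Prop :=
  dist p q ≤ ε ∧ c p = c q

theorem MonochromaticStep.symm {X K : Type*} [PseudoMetricSpace X] {c : X → K} {ε : ℝ} {p q : X}
    (h : MonochromaticStep c ε p q) : MonochromaticStep c ε q p :=
  ⟨dist_comm p q ▸ h.1, h.2.symm⟩

/-- Some monochromatic chain with steps at most `ε` leads from `p` into `S`. -/
def ChainReaches {X K : Type*} [PseudoMetricSpace X] (c : X → K) (ε : ℝ) (S : Set X) (p : X) :
    Prop :=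
  ∃ q ∈ S, Relation.ReflTransGen (MonochromaticStep c ε) p q

theorem ChainReaches.of_mem {X K : Type*} [PseudoMetricSpace X] {c : X → K} {ε : ℝ} {S : Set X}
    {p : X} (hp : p ∈ S) : ChainReaches c ε S p :=
  ⟨p, hp, .refl⟩

theorem chainReaches_iff_of_step {X K : Type*} [PseudoMetricSpace X] {c : X → K} {ε : ℝ}
    {S : Set X} {p q : X} (h : MonochromaticStep c ε p q) :
    ChainReaches c ε S p ↔ ChainReaches c ε S q :=
  ⟨fun ⟨r, hr, hpr⟩ => ⟨r, hr, .head h.symm hpr⟩, fun ⟨r, hr, hqr⟩ => ⟨r, hr, .head h hqr⟩⟩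

/-- One step from distance below 1 stays below `b`; landing at 1 or more would make equally coloured
points adjacent. -/
theorem dist_lt_one_of_chain {K : Type*} {b ε : ℝ} {c : (distanceGraph 1 b).Coloring K}
    (hεb : ε < b - 1) {p q : EuclideanSpace ℝ (Fin 2)}
    (h : Relation.ReflTransGen (MonochromaticStep c ε) p q) : dist p q < 1 ∧ c p = c q := by
  induction h with
  | refl => simp
  | @tail q r _ hqr ih =>
    have hc : c p = c r := ih.2.trans hqr.2
    refine ⟨?_, hc⟩
    by_contra! hpr
    have hne : p ≠ r := by
      rintro rfl
      rw [dist_self] at hpr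
      linarith
    refine c.valid (v := p) (w := r) ⟨hne, hpr, ?_⟩ hc
    linarith [dist_triangle p q r, hqr.1, ih.1]

theorem not_chainReaches_of_one_le {K : Type*} {b ε : ℝ} {c : (distanceGraph 1 b).Coloring K}
    (hεb : ε < b - 1) {k : Fin 2} {p : EuclideanSpace ℝ (Fin 2)} (hp : 1 ≤ p k) :
    ¬ChainReaches c ε {q | q k ≤ 0} p := by
  rintro ⟨q, hq, hpq⟩
  have h1 := (dist_lt_one_of_chain hεb hpq).1
  have h2 := PiLp.norm_apply_le (p - q) k
  rw [← dist_eq_norm, PiLp.sub_apply, Real.norm_eq_abs] at h2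
  have hq : q k ≤ 0 := hq
  linarith [le_abs_self (p k - q k)]

theorem dist_le_of_abs_sub_le_half {x y x' y' ε : ℝ} (hx : |x - x'| ≤ ε / 2)
    (hy : |y - y'| ≤ ε / 2) :
    dist (!₂[x, y] : EuclideanSpace ℝ (Fin 2)) !₂[x', y'] ≤ ε := by
  have hε : 0 ≤ ε := by linarith [abs_nonneg (x - x')]
  rw [EuclideanSpace.dist_eq]
  refine Real.sqrt_le_iff.2 ⟨hε, ?_⟩
  simp only [Fin.sum_univ_two, Real.dist_eq, sq_abs]
  have h1 := sq_le_sq' (abs_le.1 hx).1 (abs_le.1 hx).2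
  have h2 := sq_le_sq' (abs_le.1 hy).1 (abs_le.1 hy).2
  simp
  nlinarith

theorem three_le_encard_of_mem {α : Type*} {s : Set α} {x y z : α} (hx : x ∈ s) (hy : y ∈ s)
    (hz : z ∈ s) (hxy : x ≠ y) (hyz : y ≠ z) (hxz : x ≠ z) : 3 ≤ s.encard := by
  have h : ({x, y, z} : Set α).encard = 3 :=
    Set.encard_eq_three.2 ⟨x, y, z, hxy, hxz, hyz, rfl⟩
  rw [← h]
  refine Set.encard_le_encard ?_
  rintro _ (rfl | rfl | rfl) <;> assumption

theorem lemma3p1 {K : Type*} (b : ℝ) (hb : 1 < b) (c : (distanceGraph 1 b).Coloring K)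
    (ε : ℝ) (hε : 0 < ε) (hεb : ε < b - 1) :
    ∃ x : EuclideanSpace ℝ (Fin 2), 3 ≤ (c '' Metric.closedBall x ε).encard := by
  classical
  -- Mesh `ε / 2` keeps cell diagonals below `ε`; `n` cells span length at least 1.
  obtain ⟨n, hn⟩ := exists_nat_ge (1 / (ε / 2))
  rw [div_le_iff₀ (by positivity)] at hn
  let P : ℕ → ℕ → EuclideanSpace ℝ (Fin 2) := fun i j => !₂[i * (ε / 2), j * (ε / 2)]
  let label : EuclideanSpace ℝ (Fin 2) → Fin 3 := fun p =>
    if ChainReaches c ε {q | q 0 ≤ 0} p then 0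
    else if ChainReaches c ε {q | q 1 ≤ 0} p then 1 else 2
  have color_ne {p q} (hd : dist p q ≤ ε) (h : label p ≠ label q) : c p ≠ c q := fun hc =>
    h (by simp only [label, chainReaches_iff_of_step (c := c) ⟨hd, hc⟩])
  have hd : ∀ i j i' j' : ℕ, (i = i' ∨ i + 1 = i') → (j = j' ∨ j + 1 = j') →
      dist (P i j) (P i' j') ≤ ε := by
    rintro i j _ _ (rfl | rfl) (rfl | rfl) <;>
    · apply dist_le_of_abs_sub_le_half <;> rw [abs_le] <;> constructor <;> push_cast <;> linarith
  have hmem : ∀ i j i' j' : ℕ, (i = i' ∨ i + 1 = i') → (j = j' ∨ j + 1 = j') →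
      c (P i' j') ∈ c '' Metric.closedBall (P i j) ε := fun i j i' j' hi hj =>
    Set.mem_image_of_mem c (Metric.mem_closedBall'.2 (hd i j i' j' hi hj))
  obtain ⟨i, j, h | h⟩ := exists_rainbow_triangle (n := n) (L := fun i j => label (P i j))
    (fun j _ => if_pos (.of_mem (by simp [P])))
    (fun i _ => by
      have h : ChainReaches c ε {q | q 1 ≤ 0} (P i 0) := .of_mem (by simp [P])
      simp only [label, h, if_true]
      split_ifs <;> decide)
    (fun j _ => by
      have h : ¬ChainReaches c ε {q | q 0 ≤ 0} (P n j) := not_chainReaches_of_one_le hεb hn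
      simp only [label, h, if_false]
      split_ifs <;> decide)
    (fun i _ => by
      have h : ¬ChainReaches c ε {q | q 1 ≤ 0} (P i n) := not_chainReaches_of_one_le hεb hn
      simp only [label, h, if_false]
      split_ifs <;> decide)
  all_goals
    refine ⟨P i j, three_le_encard_of_mem ?_ ?_ ?_ (color_ne ?_ h.1) (color_ne ?_ h.2.1)
      (color_ne ?_ h.2.2)⟩
    all_goals first | apply hmem <;> simp | apply hd <;> simp
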